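/- Let $\mathbb{H}$ be Philip Hall's universal locally finite group, that is, the countably infinite locally finite group (unique up to isomorphism) such that every finite group embeds in $\mathbb{H}$ and any two isomorphic finite subgroups of $\mathbb{H}$ are conjugate in $\mathbb{H}$. Equip $\mathrm{Aut}(\mathbb{H})$ with the topology of pointwise convergence (the topology induced from the product $\mathbb{H}^{\mathbb{H}}$ with $\mathbb{H}$ discrete), and call $g\in\mathrm{Aut}(\mathbb{H})$ generic if its conjugacy class in $\mathrm{Aut}(\mathbb{H})$ is comeager. Theorem. Let $g$ be a generic automorphism of $\mathbb{H}$. Then $g$ is conjugate in $\mathrm{Aut}(\mathbb{H})$ to $g^n$ for every integer $n\neq 0$, and $g$ has roots of all orders: for every integer $n\geq 1$ there is $h\in\mathrm{Aut}(\mathbb{H})$ with $h^n=g$. Moreover, there is an action of $(\mathbb{Q},+)$ on $\mathbb{H}$ by group automorphisms, that is, a homomorphism $\varphi\colon(\mathbb{Q},+)\to\mathrm{Aut}(\mathbb{H})$, such that $\varphi(1)=g$. -/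

import Mathlib

/-- A group is locally finite if each of its finitely generated subgroups is finite. -/
def IsLocallyFiniteGroup (H : Type*) [Group H] : Prop :=
  ∀ K : Subgroup H, K.FG → Finite K

/-- `H` is (a copy of) Philip Hall's universal locally finite group: the countably infinite
locally finite group, unique up to isomorphism, such that every finite group embeds in it and
any two isomorphic finite subgroups are conjugate in it. -/
structure IsHallUniversal (H : Type*) [Group H] : Prop where
  countable : Countable H
  infinite : Infinite H
  locallyFinite : IsLocallyFiniteGroup H
  /-- Every finite group embeds (each finite group has an isomorphic copy in `Type`). -/
  embeds : ∀ (G : Type) [Group G] [Finite G], ∃ f : G →* H, Function.Injective f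
  /-- Isomorphic finite subgroups `K`, `L` are conjugate: `L = h K h⁻¹` for some `h`. -/
  conj : ∀ K L : Subgroup H, Finite K → Finite L → Nonempty (K ≃* L) →
    ∃ h : H, L = K.map (MulAut.conj h).toMonoidHom

/-- The topology of pointwise convergence on `Aut(H)`: the topology induced from the product
topology on `H → H`, where `H` is discrete. -/
@[reducible] def autTopology (H : Type*) [Group H] : TopologicalSpace (MulAut H) :=
  TopologicalSpace.induced (fun (g : MulAut H) (x : H) => g x)
    (@Pi.topologicalSpace H (fun _ => H) (fun _ => ⊥))

/-- An automorphism is generic if its conjugacy class in `Aut(H)` is comeager. -/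
def IsGenericAut {H : Type*} [Group H] (g : MulAut H) : Prop :=
  {h : MulAut H | IsConj g h} ∈ @residual (MulAut H) (autTopology H)

/-! Homogeneity makes inner automorphisms dense in `Aut(H)`, so density questions become
computations in `H`. The crux is `exists_mem_pow_mem`: the preimage of a dense open set `D` under `h
↦ h ^ n` is dense. Near conjugation by `c`, pick `d` with conjugation by `d` in `D` and agreeing
with that by `c ^ n` on a finite set containing `c`. The error `c ^ (-n) * d` centralizes this set,
hence has an `n`-th root `s` that does too, and `(c * s) ^ n = d`. Thus the comeager class of `g`
has comeager preimage under the power map, and Baire category gives a conjugate `h` of `g` with `h ^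
n` also conjugate to `g`. So `g` is conjugate to `g ^ n`. Roots follow by conjugating back; they
stay in the class of `g`, so extraction can be iterated to define rational powers. -/

/-! ### Embeddings of finite groups into Hall's universal group -/

namespace IsHallUniversal

variable {H : Type*} [Group H]

/-- Every finite group, in any universe, embeds in Hall's group. -/
theorem exists_embedding (hH : IsHallUniversal H) (G : Type*) [Group G] [Finite G] :
    ∃ f : G →* H, Function.Injective f := by
  obtain ⟨f, hf⟩ := hH.embeds (Shrink.{0} G)
  exact ⟨f.comp (Shrink.mulEquiv.{0} (α := G)).symm.toMonoidHom,
    hf.comp (Shrink.mulEquiv.{0} (α := G)).symm.injective⟩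

theorem finite_closure (hH : IsHallUniversal H) {s : Set H} (hs : s.Finite) :
    Finite (Subgroup.closure s) :=
  hH.locallyFinite _ ((Subgroup.fg_iff _).2 ⟨s, rfl, hs⟩)

/-- Two embeddings of a finite group have the same image up to an inner automorphism, hence
differ by an inner automorphism and an automorphism of the finite group. -/
theorem exists_conj_comp_mulEquiv (hH : IsHallUniversal H) {A : Type*} [Group A] [Finite A]
    (u v : A →* H) (hu : Function.Injective u) (hv : Function.Injective v) :
    ∃ (h : H) (θ : A ≃* A), ∀ a, v (θ a) = h * u a * h⁻¹ := by
  obtain ⟨h, hh⟩ := hH.conj u.range v.range (Finite.of_equiv A (MonoidHom.ofInjective hu).toEquiv)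
    (Finite.of_equiv A (MonoidHom.ofInjective hv).toEquiv)
    ⟨(MonoidHom.ofInjective hu).symm.trans (MonoidHom.ofInjective hv)⟩
  have key (a : A) : h * u a * h⁻¹ ∈ v.range := by
    rw [hh]
    exact ⟨u a, ⟨a, rfl⟩, by simp⟩
  let w : A →* v.range := ((MulAut.conj h).toMonoidHom.comp u).codRestrict v.range
    fun a => by simpa using key a
  have hw (a : A) : (w a : H) = h * u a * h⁻¹ := by simp [w]
  let θ : A →* A := (MonoidHom.ofInjective hv).symm.toMonoidHom.comp w
  have hθ (a : A) : v (θ a) = h * u a * h⁻¹ := by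
    rw [← hw]
    exact congrArg Subtype.val ((MonoidHom.ofInjective hv).apply_symm_apply (w a))
  have hinj : Function.Injective θ := fun a b hab => by
    have := congrArg v hab
    rw [hθ, hθ] at this
    exact hu (by simpa using this)
  exact ⟨h, MulEquiv.ofBijective θ (Finite.injective_iff_bijective.1 hinj), hθ⟩

/-- Automorphisms of a finite group become inner in its symmetric group. -/
theorem toPermHom_mulEquiv_apply {A : Type*} [Group A] (σ : A ≃* A) (a : A) :
    MulAction.toPermHom A A (σ a) =
      σ.toEquiv * MulAction.toPermHom A A a * (σ.toEquiv : Equiv.Perm A)⁻¹ := by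
  ext x
  simp [Equiv.Perm.mul_apply, Equiv.Perm.inv_def]

/-- Any two embeddings of a finite group into Hall's group are conjugate. -/
theorem exists_conj_eq (hH : IsHallUniversal H) {A : Type*} [Group A] [Finite A]
    (u v : A →* H) (hu : Function.Injective u) (hv : Function.Injective v) :
    ∃ h : H, ∀ a, v a = h * u a * h⁻¹ := by
  obtain ⟨f, hf⟩ := hH.exists_embedding (Equiv.Perm A)
  have hi : Function.Injective (f.comp (MulAction.toPermHom A A)) :=
    hf.comp MulAction.toPerm_injective
  obtain ⟨h₁, θ₁, h₁θ⟩ := hH.exists_conj_comp_mulEquiv _ _ hu hi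
  obtain ⟨h₂, θ₂, h₂θ⟩ := hH.exists_conj_comp_mulEquiv _ _ hv hi
  -- The discrepancy between `θ₁` and `θ₂` is an automorphism of `A`; it is inner in `Equiv.Perm A`,
  -- so `f s` realizes it in `H`.
  let s : Equiv.Perm A := (θ₁.symm.trans θ₂).toEquiv
  refine ⟨h₂⁻¹ * f s * h₁, fun a => ?_⟩
  have h₃ : f (MulAction.toPermHom A A (θ₂ a)) =
      f s * f (MulAction.toPermHom A A (θ₁ a)) * (f s)⁻¹ := by
    have := toPermHom_mulEquiv_apply (θ₁.symm.trans θ₂) (θ₁ a)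
    simp only [MulEquiv.trans_apply, MulEquiv.symm_apply_apply] at this
    rw [this, map_mul, map_mul, map_inv]
  have e₁ := h₁θ a
  have e₂ := h₂θ a
  simp only [MonoidHom.comp_apply] at e₁ e₂
  rw [e₁, e₂] at h₃
  have : v a = h₂⁻¹ * (h₂ * v a * h₂⁻¹) * h₂ := by group
  rw [this, h₃]
  group

/-- Embeddings of finite groups extend along inclusions into larger finite groups. -/
theorem exists_extension (hH : IsHallUniversal H) {A G : Type*} [Group A] [Group G] [Finite G]
    (i : A →* G) (hi : Function.Injective i) (u : A →* H) (hu : Function.Injective u) :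
    ∃ f : G →* H, ∀ a, f (i a) = u a := by
  have : Finite A := Finite.of_injective i hi
  obtain ⟨f, hf⟩ := hH.exists_embedding G
  obtain ⟨h, hh⟩ := hH.exists_conj_eq (f.comp i) u (hf.comp hi) hu
  exact ⟨(MulAut.conj h).toMonoidHom.comp f, fun a => by simp [hh]⟩

/-- On a finite set, every automorphism agrees with an inner one. -/
theorem exists_conj_eqOn (hH : IsHallUniversal H) (k : MulAut H) (F : Finset H) :
    ∃ c : H, ∀ x ∈ F, MulAut.conj c x = k x := by
  have := hH.finite_closure F.finite_toSet
  obtain ⟨c, hc⟩ := hH.exists_conj_eq (Subgroup.closure (F : Set H)).subtype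
    (k.toMonoidHom.comp (Subgroup.closure (F : Set H)).subtype) Subtype.val_injective
    (k.injective.comp Subtype.val_injective)
  exact ⟨c, fun x hx => (hc ⟨x, Subgroup.subset_closure hx⟩).symm⟩

end IsHallUniversal

/-! ### Roots in centralizers -/

/-- The map on `n` copies of `B` that moves each copy to the next one, and the last copy to the
first one after left multiplication by `w`. -/
def cyclicShift {B : Type*} [Mul B] (n : ℕ) [NeZero n] (w : B) (x : B × Fin n) : B × Fin n :=
  (if x.2 + 1 < n then x.1 else w * x.1, Fin.ofNat n (x.2 + 1))

/-- The exponent of `w` counts how often the copy index has wrapped around. -/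
theorem cyclicShift_iterate {B : Type*} [Monoid B] (n : ℕ) [NeZero n] (w : B) (k : ℕ)
    (x : B × Fin n) :
    (cyclicShift n w)^[k] x = (w ^ ((x.2 + k) / n) * x.1, Fin.ofNat n (x.2 + k)) := by
  induction k with
  | zero => ext <;> simp [Nat.div_eq_of_lt x.2.isLt]
  | succ k ih =>
    have hn : 0 < n := Nat.pos_of_neZero n
    rw [Function.iterate_succ_apply', ih, cyclicShift]
    ext
    · simp only [Fin.val_ofNat]
      rw [← add_assoc, Nat.succ_div]
      have hiff : n ∣ (x.2 : ℕ) + k + 1 ↔ ¬ ((x.2 : ℕ) + k) % n + 1 < n := by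
        have := Nat.mod_lt ((x.2 : ℕ) + k) hn
        rw [Nat.dvd_iff_mod_eq_zero, Nat.add_mod]
        rcases Nat.lt_or_ge (((x.2 : ℕ) + k) % n + 1) n with h | h
        · have h1 : 1 % n = 1 := Nat.mod_eq_of_lt (by omega)
          rw [h1, Nat.mod_eq_of_lt h]
          omega
        · have h1 : ((x.2 : ℕ) + k) % n + 1 = n := by omega
          rw [Nat.add_mod_mod, h1, Nat.mod_self]
          omega
      by_cases h : ((x.2 : ℕ) + k) % n + 1 < n
      · simp [h, hiff]
      · simp [h, hiff, pow_succ', mul_assoc]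
    · simp [add_assoc]

theorem cyclicShift_iterate_self {B : Type*} [Monoid B] (n : ℕ) [NeZero n] (w : B)
    (x : B × Fin n) : (cyclicShift n w)^[n] x = (w * x.1, x.2) := by
  have hn : 0 < n := Nat.pos_of_neZero n
  rw [cyclicShift_iterate]
  ext <;> simp [Nat.add_div_right _ hn, Nat.div_eq_of_lt x.2.isLt, Nat.mod_eq_of_lt x.2.isLt]

/-- In Hall's group, an element centralizing a finite set has roots of all orders that centralize
this set. -/
theorem IsHallUniversal.exists_root_commute {H : Type*} [Group H] (hH : IsHallUniversal H)
    (A : Finset H) (w : H) (hw : ∀ a ∈ A, Commute w a) (n : ℕ) (hn : n ≠ 0) :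
    ∃ s : H, s ^ n = w ∧ ∀ a ∈ A, Commute s a := by
  classical
  have : NeZero n := ⟨hn⟩
  let B := Subgroup.closure ((insert w A : Finset H) : Set H)
  have : Finite B := hH.finite_closure (Finset.finite_toSet _)
  have hB (x : H) (hx : x ∈ insert w A) : x ∈ B := Subgroup.subset_closure hx
  let w' : B := ⟨w, hB w (by simp)⟩
  have hinj : Function.Injective (cyclicShift n w') := by
    refine Function.Injective.of_comp (f := (cyclicShift n w')^[n - 1]) ?_
    rw [← Function.iterate_succ, Nat.succ_eq_add_one, Nat.sub_add_cancel (Nat.pos_of_ne_zero hn)]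
    intro x y hxy
    rw [cyclicShift_iterate_self, cyclicShift_iterate_self] at hxy
    simpa [Prod.ext_iff] using hxy
  let s : Equiv.Perm (B × Fin n) :=
    Equiv.ofBijective _ (Finite.injective_iff_bijective.1 hinj)
  have hs (x : B × Fin n) : s x = cyclicShift n w' x := rfl
  -- `B` acts by left multiplication on every copy at once, so `s` is an `n`-th root of the action
  -- of `w'`.
  let i : B →* Equiv.Perm (B × Fin n) :=
    { toFun := fun b => (Equiv.mulLeft b).prodCongr (Equiv.refl _)
      map_one' := by ext <;> simp
      map_mul' := fun a b => by ext <;> simp [mul_assoc] }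
  have hi_apply (b : B) (x : B × Fin n) : i b x = (b * x.1, x.2) := rfl
  have hi : Function.Injective i := fun a b hab => by
    have := congrArg (fun e : Equiv.Perm (B × Fin n) => (e (1, 0)).1) hab
    simpa [hi_apply] using this
  have hsn : s ^ n = i w' := by
    ext1 x
    rw [hi_apply, ← cyclicShift_iterate_self n w' x, Equiv.Perm.coe_pow]
    rfl
  have hcomm (a : B) (ha : Commute w' a) : Commute s (i a) := by
    ext1 x
    simp only [Equiv.Perm.mul_apply, hi_apply, hs, cyclicShift]
    split_ifs
    · rfl
    · rw [← mul_assoc, ha.eq, mul_assoc]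
  obtain ⟨f, hf⟩ := hH.exists_extension i hi B.subtype Subtype.val_injective
  refine ⟨f s, by rw [← map_pow, hsn, hf]; rfl, fun a ha => ?_⟩
  have := (hcomm ⟨a, hB a (by simp [ha])⟩ (Subtype.ext (hw a ha))).map f
  rwa [hf] at this

/-! ### The topology of `Aut(H)` -/

section AutTopology

open Topology

variable {H : Type*} [Group H]

theorem isOpen_autTopology_iff {U : Set (MulAut H)} :
    IsOpen[autTopology H] U ↔
      ∀ h ∈ U, ∃ F : Finset H, ∀ k : MulAut H, (∀ x ∈ F, k x = h x) → k ∈ U := by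
  let : TopologicalSpace H := ⊥
  have : DiscreteTopology H := ⟨rfl⟩
  let := autTopology H
  rw [isOpen_iff_mem_nhds]
  refine forall₂_congr fun h _ => ?_
  rw [nhds_induced, nhds_pi, Filter.mem_comap]
  constructor
  · rintro ⟨t, ht, htU⟩
    obtain ⟨I, hI, s, hs, hst⟩ := Filter.mem_pi.1 ht
    refine ⟨hI.toFinset, fun k hk => htU (hst fun x hx => ?_)⟩
    change k x ∈ s x
    rw [hk x (by simpa using hx)]
    exact mem_of_mem_nhds (hs x)
  · rintro ⟨F, hF⟩
    refine ⟨(F : Set H).pi fun x => {h x}, ?_, fun k hk => hF k fun x hx => hk x hx⟩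
    exact Filter.pi_mem_pi F.finite_toSet fun x _ => by simp

theorem continuous_pow_autTopology (n : ℕ) :
    @Continuous _ _ (autTopology H) (autTopology H) (fun h : MulAut H => h ^ n) := by
  let := autTopology H
  classical
  refine ⟨fun U hU => isOpen_autTopology_iff.2 fun h hh => ?_⟩
  obtain ⟨F, hF⟩ := isOpen_autTopology_iff.1 hU _ hh
  -- Control is needed along the first `n` points of each `h`-orbit starting in `F`.
  refine ⟨(Finset.range n).biUnion fun i => F.image fun x => (h ^ i) x, fun k hk => ?_⟩
  refine hF _ fun x hx => ?_
  have (j : ℕ) (hj : j ≤ n) : (k ^ j) x = (h ^ j) x := by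
    induction j with
    | zero => rfl
    | succ j ih =>
      rw [pow_succ', pow_succ', MulAut.mul_apply, MulAut.mul_apply, ih (by omega)]
      refine hk _ (Finset.mem_biUnion.2 ⟨j, Finset.mem_range.2 hj, Finset.mem_image_of_mem _ hx⟩)
  exact this n le_rfl

theorem continuous_inv_autTopology :
    @Continuous _ _ (autTopology H) (autTopology H) (fun h : MulAut H => h⁻¹) := by
  let := autTopology H
  classical
  refine ⟨fun U hU => isOpen_autTopology_iff.2 fun h hh => ?_⟩
  obtain ⟨F, hF⟩ := isOpen_autTopology_iff.1 hU _ hh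
  refine ⟨F.image fun x => h⁻¹ x, fun k hk => hF _ fun x hx => ?_⟩
  have := hk _ (Finset.mem_image_of_mem _ hx)
  rw [MulAut.apply_inv_self] at this
  rw [← this, MulAut.inv_apply_self, this]

/-- Recording `g⁻¹` alongside `g` makes the image closed: a pointwise limit of automorphisms alone
need not be surjective. -/
theorem baireSpace_autTopology [Countable H] : @BaireSpace (MulAut H) (autTopology H) := by
  let : TopologicalSpace H := ⊥
  have : DiscreteTopology H := ⟨rfl⟩
  let := autTopology H
  have hc : Continuous fun (g : MulAut H) (x : H) => g x := continuous_induced_dom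
  let e : MulAut H → (H → H) × (H → H) := fun g => (fun x => g x, fun x => g⁻¹ x)
  have he : Topology.IsClosedEmbedding e := by
    refine ⟨⟨?_, fun g h hgh => MulEquiv.ext fun x => congrFun (congrArg Prod.fst hgh) x⟩, ?_⟩
    · exact .of_comp (hc.prodMk (hc.comp continuous_inv_autTopology)) continuous_fst ⟨rfl⟩
    · have : Set.range e = {p | (∀ x, p.2 (p.1 x) = x) ∧ (∀ x, p.1 (p.2 x) = x) ∧
          ∀ x y, p.1 (x * y) = p.1 x * p.1 y} := by
        ext p
        constructor
        · rintro ⟨g, rfl⟩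
          simp [e]
        · rintro ⟨h₁, h₂, h₃⟩
          exact ⟨⟨⟨p.1, p.2, h₁, h₂⟩, h₃⟩, rfl⟩
      have ev : Continuous fun p : H × (H → H) => p.2 p.1 :=
        continuous_prod_of_discrete_left.2 fun a => by fun_prop
      have h₁ (x : H) : Continuous fun p : (H → H) × (H → H) => p.2 (p.1 x) :=
        ev.comp (f := fun p : (H → H) × (H → H) => (p.1 x, p.2)) (by fun_prop)
      have h₂ (x : H) : Continuous fun p : (H → H) × (H → H) => p.1 (p.2 x) :=
        ev.comp (f := fun p : (H → H) × (H → H) => (p.2 x, p.1)) (by fun_prop)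
      simp only [this, Set.ofPred_and, Set.ofPred_forall]
      refine (isClosed_iInter fun x => isClosed_eq (h₁ x) continuous_const).inter
        ((isClosed_iInter fun x => isClosed_eq (h₂ x) continuous_const).inter
          (isClosed_iInter fun x => isClosed_iInter fun y => isClosed_eq ?_ ?_)) <;> fun_prop
  have := he.IsCompletelyMetrizableSpace
  infer_instance

end AutTopology

/-! ### Powers of generic automorphisms -/

section Generic

open Topology

variable {H : Type*} [Group H]

/-- The inverse image of a dense open set under a power map is dense. -/
theorem IsHallUniversal.exists_mem_pow_mem (hH : IsHallUniversal H) {n : ℕ} (hn : n ≠ 0)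
    {D U : Set (MulAut H)} (hDo : IsOpen[autTopology H] D)
    (hD : @Dense _ (autTopology H) D) (hU : IsOpen[autTopology H] U) (hne : U.Nonempty) :
    ∃ h ∈ U, h ^ n ∈ D := by
  let := autTopology H
  classical
  obtain ⟨h₀, hh₀⟩ := hne
  obtain ⟨F, hF⟩ := isOpen_autTopology_iff.1 hU h₀ hh₀
  obtain ⟨c, hc⟩ := hH.exists_conj_eqOn h₀ F
  -- Including `c` forces the root `s` to commute with `c`, so that `(c * s) ^ n = c ^ n * s ^ n`.
  let A := insert c F
  have hV : IsOpen {k : MulAut H | ∀ x ∈ A, k x = MulAut.conj (c ^ n) x} :=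
    isOpen_autTopology_iff.2 fun h hh => ⟨A, fun k hk x hx => (hk x hx).trans (hh x hx)⟩
  obtain ⟨k, hkV, hkD⟩ := hD.inter_open_nonempty _ hV ⟨MulAut.conj (c ^ n), fun _ _ => rfl⟩
  obtain ⟨F', hF'⟩ := isOpen_autTopology_iff.1 hDo k hkD
  obtain ⟨d, hd⟩ := hH.exists_conj_eqOn k (F' ∪ A)
  have hcomm (a : H) (ha : a ∈ A) : Commute (c ^ (-n : ℤ) * d) a := by
    have h₁ : MulAut.conj d a = MulAut.conj (c ^ n) a :=
      (hd a (Finset.mem_union_right _ ha)).trans (hkV a ha)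
    simp only [MulAut.conj_apply] at h₁
    have h₂ : d * a = c ^ n * a * (c ^ n)⁻¹ * d := by rw [← h₁]; group
    rw [commute_iff_eq, mul_assoc, h₂, zpow_neg, zpow_natCast]
    group
  obtain ⟨s, hsn, hs⟩ := hH.exists_root_commute A _ hcomm n hn
  refine ⟨MulAut.conj (c * s), hF _ fun x hx => ?_, hF' _ fun x hx => ?_⟩
  · rw [← hc x hx, map_mul, MulAut.mul_apply]
    congr 1
    rw [MulAut.conj_apply, (hs x (Finset.mem_insert_of_mem hx)).eq, mul_inv_cancel_right]
  · rw [← hd x (Finset.mem_union_left _ hx), ← map_pow,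
      (hs c (Finset.mem_insert_self _ _)).symm.mul_pow, hsn, zpow_neg, zpow_natCast,
      mul_inv_cancel_left]

theorem mem_residual_preimage {X : Type*} [TopologicalSpace X] {f : X → X} (hf : Continuous f)
    (hd : ∀ D : Set X, IsOpen D → Dense D → Dense (f ⁻¹' D)) {s : Set X} (hs : s ∈ residual X) :
    f ⁻¹' s ∈ residual X := by
  obtain ⟨S, hSo, hSd, hSc, hS⟩ := mem_residual_iff.1 hs
  refine mem_residual_iff.2 ⟨(f ⁻¹' ·) '' S, ?_, ?_, hSc.image _, ?_⟩
  · rintro _ ⟨t, ht, rfl⟩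
    exact (hSo t ht).preimage hf
  · rintro _ ⟨t, ht, rfl⟩
    exact hd t (hSo t ht) (hSd t ht)
  · intro x hx
    exact hS fun t ht => hx _ ⟨t, ht, rfl⟩

/-- If inverse images of dense open sets under `f` are dense, then a generic automorphism `g` is
conjugate to `f h` for some conjugate `h` of `g`. -/
theorem IsGenericAut.exists_isConj [Countable H] {g : MulAut H} (hg : IsGenericAut g)
    {f : MulAut H → MulAut H} (hf : @Continuous _ _ (autTopology H) (autTopology H) f)
    (hd : ∀ D, IsOpen[autTopology H] D → @Dense _ (autTopology H) D →
      @Dense _ (autTopology H) (f ⁻¹' D)) :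
    ∃ h, IsConj g h ∧ IsConj g (f h) := by
  let := autTopology H
  have := baireSpace_autTopology (H := H)
  have := Filter.inter_mem hg (mem_residual_preimage hf hd hg)
  exact (dense_of_mem_residual this).nonempty

theorem IsGenericAut.isConj_inv [Countable H] {g : MulAut H} (hg : IsGenericAut g) :
    IsConj g g⁻¹ := by
  let := autTopology H
  let e : MulAut H ≃ₜ MulAut H :=
    { toEquiv := Equiv.inv _
      continuous_toFun := continuous_inv_autTopology
      continuous_invFun := continuous_inv_autTopology }
  obtain ⟨h, h₁, h₂⟩ := hg.exists_isConj continuous_inv_autTopology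
    fun D _ hD => hD.preimage e.isOpenMap
  obtain ⟨c, hc⟩ := isConj_iff.1 h₁
  exact h₂.trans (isConj_iff.2 ⟨c, by rw [← hc]; group⟩).symm

theorem IsConj.pow_pow {G : Type*} [Group G] {a b : G} (h : IsConj a b) (n : ℕ) :
    IsConj (a ^ n) (b ^ n) := by
  obtain ⟨c, rfl⟩ := isConj_iff.1 h
  exact isConj_iff.2 ⟨c, conj_pow.symm⟩

theorem IsGenericAut.isConj_pow (hH : IsHallUniversal H) {g : MulAut H} (hg : IsGenericAut g)
    {n : ℕ} (hn : n ≠ 0) : IsConj g (g ^ n) := by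
  have := hH.countable
  let := autTopology H
  obtain ⟨h, h₁, h₂⟩ := hg.exists_isConj (continuous_pow_autTopology n) fun D hDo hD =>
    dense_iff_inter_open.2 fun U hU hne => hH.exists_mem_pow_mem hn hDo hD hU hne
  exact h₂.trans (h₁.pow_pow n).symm

theorem IsGenericAut.isConj_zpow (hH : IsHallUniversal H) {g : MulAut H} (hg : IsGenericAut g)
    {n : ℤ} (hn : n ≠ 0) : IsConj g (g ^ n) := by
  have := hH.countable
  obtain ⟨m, rfl | rfl⟩ := n.eq_nat_or_neg
  · rw [zpow_natCast]
    exact hg.isConj_pow hH (by simpa using hn)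
  · rw [zpow_neg, zpow_natCast, ← inv_pow]
    exact (hg.isConj_pow hH (by simpa using hn)).trans (hg.isConj_inv.pow_pow m)

end Generic

/-! ### Rational powers -/

theorem IsConj.exists_isConj_pow_eq {G : Type*} [Group G] {g x : G} {n : ℕ}
    (h : IsConj g (g ^ n)) (hx : IsConj g x) : ∃ y, IsConj g y ∧ y ^ n = x := by
  obtain ⟨c, hc⟩ := isConj_iff.1 (h.symm.trans hx)
  exact ⟨c * g * c⁻¹, isConj_iff.2 ⟨c, rfl⟩, by rw [conj_pow, hc]⟩

/-- A coherent sequence of roots of `u 0` defines rational powers of `u 0`. -/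
theorem exists_rat_hom_of_pow_eq {G : Type*} [Group G] (u : ℕ → G)
    (hu : ∀ k, u (k + 1) ^ (k + 1) = u k) :
    ∃ φ : Multiplicative ℚ →* G, φ (Multiplicative.ofAdd 1) = u 0 := by
  -- Think of `u k` as the root of `u 0` of order `k!`.
  have huk (k j : ℕ) : u (k + j) ^ ((k + j).factorial / k.factorial) = u k := by
    induction j with
    | zero => simp [Nat.div_self (Nat.factorial_pos k)]
    | succ j ih =>
      rw [← add_assoc, Nat.factorial_succ,
        Nat.mul_div_assoc _ (Nat.factorial_dvd_factorial (Nat.le_add_right k j)), pow_mul, hu, ih]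
  have hle {k l : ℕ} (hkl : k ≤ l) : ∃ m : ℕ, l.factorial = k.factorial * m ∧ u l ^ m = u k := by
    obtain ⟨j, rfl⟩ := Nat.exists_eq_add_of_le hkl
    exact ⟨_, (Nat.mul_div_cancel' (Nat.factorial_dvd_factorial hkl)).symm, huk k j⟩
  have hcoh {k l : ℕ} (hkl : k ≤ l) {q : ℚ} {a b : ℤ} (ha : q * k.factorial = a)
      (hb : q * l.factorial = b) : u k ^ a = u l ^ b := by
    obtain ⟨m, hm, hum⟩ := hle hkl
    have : b = m * a := by
      have : (b : ℚ) = m * a := by rw [← hb, ← ha, hm]; push_cast; ring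
      exact_mod_cast this
    rw [← hum, this, zpow_mul, zpow_natCast]
  have hint (q : ℚ) (k : ℕ) (hk : q.den ≤ k) : ∃ a : ℤ, q * k.factorial = a := by
    obtain ⟨m, hm⟩ := Nat.dvd_factorial q.pos hk
    refine ⟨q.num * m, ?_⟩
    rw [hm]
    push_cast
    rw [← mul_assoc, Rat.mul_den_eq_num]
  -- The power `q` is `u k ^ (q * k!)` for any `k` making the exponent integral; `k = q.den` is one
  -- choice, and `hcoh` shows independence.
  choose N hN using fun q : ℚ => hint q q.den le_rfl
  have hval (q : ℚ) (k : ℕ) (hk : q.den ≤ k) (a : ℤ) (ha : q * k.factorial = a) :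
      u q.den ^ N q = u k ^ a := hcoh hk (hN q) ha
  let φ : Multiplicative ℚ →* G := MonoidHom.mk' (fun q => u q.toAdd.den ^ N q.toAdd) <| by
    intro p q
    let k := max (p * q).toAdd.den (max p.toAdd.den q.toAdd.den)
    obtain ⟨a, ha⟩ := hint p.toAdd k (by simp [k])
    obtain ⟨b, hb⟩ := hint q.toAdd k (by simp [k])
    rw [hval _ k (by simp [k]) a ha, hval _ k (by simp [k]) b hb,
      hval _ k (by simp [k]) (a + b) (by push_cast; rw [toAdd_mul, add_mul, ha, hb]), zpow_add]
  refine ⟨φ, ?_⟩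
  have h₀ : u 0 = u 1 := by simpa using (hu 0).symm
  change u (1 : ℚ).den ^ N 1 = u 0
  rw [hval 1 1 (by simp) 1 (by simp), zpow_one, h₀]

theorem mainTheorem5 {H : Type*} [Group H] (hH : IsHallUniversal H)
    (g : MulAut H) (hg : IsGenericAut g) :
    (∀ n : ℤ, n ≠ 0 → IsConj g (g ^ n)) ∧
    (∀ n : ℕ, n ≠ 0 → ∃ h : MulAut H, h ^ n = g) ∧
    (∃ φ : Multiplicative ℚ →* MulAut H, φ (Multiplicative.ofAdd 1) = g) := by
  have hroot (n : ℕ) (hn : n ≠ 0) (x : MulAut H) (hx : IsConj g x) :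
      ∃ y, IsConj g y ∧ y ^ n = x := (hg.isConj_pow hH hn).exists_isConj_pow_eq hx
  refine ⟨fun n hn => hg.isConj_zpow hH hn, fun n hn => ?_, ?_⟩
  · obtain ⟨y, -, hy⟩ := hroot n hn g (IsConj.refl g)
    exact ⟨y, hy⟩
  · choose! r hr hrn using fun n : ℕ => hroot (n + 1) n.succ_ne_zero
    let u : ℕ → MulAut H := fun k => Nat.rec g (fun n x => r n x) k
    have hu (k : ℕ) : IsConj g (u k) := by
      induction k with
      | zero => exact IsConj.refl g
      | succ k ih => exact hr k _ ih
    exact exists_rat_hom_of_pow_eq u fun k => hrn k _ (hu k)
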